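/- Let $V$ be a finite set of points in the plane in general position (no three points of $V$ are collinear and no four points of $V$ are cocircular). Write $|uv|$ for Euclidean distance, $D(c;r)$ for the closed disk with center $c$ and radius $r$, $\partial D$ and $\mathrm{int}(D)$ for the boundary and the interior of a disk $D$, and $N_v=\{u\in V: |uv|\le 1\}$ for $v\in V$. For a finite set $S$ of points in the plane, the Delaunay triangulation of $S$ has vertex set $S$; distinct $u,v\in S$ form an edge if and only if there is a disk $D$ with $S\cap\partial D=\{u,v\}$ and $S\cap \mathrm{int}(D)=\emptyset$; three distinct points of $S$ form a triangular face if and only if the disk having them on its boundary has no point of $S$ in its interior. Two segments cross if they are not collinear and some point is in the relative interior of both. Let $UDel(V)$ be the graph with vertex set $V$ whose edges are the edges $(u,v)$ of the Delaunay triangulation of $V$ with $|uv|\le 1$. The graph $PLDG(V)$ is computed by the following distributed algorithm, run by every $v\in V$. Point $v$ computes the Delaunay triangulation $LDT(v)$ of $N_v$, lets $E(v)$ be the set of edges of $LDT(v)$ incident on $v$, and broadcasts $v$ together with the circumcenters of all triangular faces $\Delta(u,v,w)$ of $LDT(v)$ with $\angle uvw>\pi/3$; the broadcast reaches the points of $V$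 at distance at most $1$ from $v$. Then, for each center $c$ that $v$ receives from a point $x$ such that the circle $C=\partial D(c;|cx|)$ contains exactly two points $x$ and $p$ of $N_v$, point $v$ sets $arc=C\setminus D(v;1)$, chooses an arbitrary point $z'\in arc$ with $|xz'|\le1$ or $|pz'|\le 1$ and, for each edge $(v,y)$ in $E(v)$, chooses an arbitrary disk $Del_v(v,y)$ with $N_v\cap\partial Del_v(v,y)=\{v,y\}$ and $N_v\cap \mathrm{int}(Del_v(v,y))=\emptyset$; it removes $(v,y)$ from $E(v)$ if $arc\subseteq \mathrm{int}(Del_v(v,y))$ and the segment $vy$ crosses at least one of the segments $xz'$ and $pz'$. Finally, $PLDG(V)$ is the graph with vertex set $V$ and edge set $\bigcup_{v\in V}E(v)$, where $E(v)$ are the sets obtained at the end. Then, for all possible choices of the points $z'$ and the disks $Del_v(v,y)$ made by the algorithm, $UDel(V)$ is a subgraph of $PLDG(V)$. -/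

import Mathlib

open scoped EuclideanGeometry

/-- The Euclidean plane. -/
abbrev Plane : Type := EuclideanSpace ℝ (Fin 2)

/-- No three points of `V` are collinear and no four points of `V` are cocircular. -/
structure InGeneralPosition (V : Set Plane) : Prop where
  not_collinear : ∀ a ∈ V, ∀ b ∈ V, ∀ c ∈ V, a ≠ b → a ≠ c → b ≠ c →
    ¬ Collinear ℝ {a, b, c}
  not_cocircular : ∀ a ∈ V, ∀ b ∈ V, ∀ c ∈ V, ∀ d ∈ V,
    a ≠ b → a ≠ c → a ≠ d → b ≠ c → b ≠ d → c ≠ d →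
    ¬ EuclideanGeometry.Cospherical {a, b, c, d}

/-- A (closed) disk in the plane. -/
structure Disk where
  center : Plane
  radius : ℝ
  radius_pos : 0 < radius

/-- The boundary circle of a disk. -/
def Disk.boundary (D : Disk) : Set Plane := Metric.sphere D.center D.radius

/-- The interior of a disk. -/
def Disk.int (D : Disk) : Set Plane := Metric.ball D.center D.radius

/-- `D` is an empty disk for the pair `u, v` in `S`: the points of `S` on its boundary are exactly
`u` and `v`, and no point of `S` is in its interior. -/
def IsEmptyDisk (S : Set Plane) (u v : Plane) (D : Disk) : Prop :=
  S ∩ D.boundary = {u, v} ∧ S ∩ D.int = ∅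

/-- `(u, v)` is an edge of the Delaunay triangulation of `S`. -/
def IsDelaunayEdge (S : Set Plane) (u v : Plane) : Prop :=
  u ∈ S ∧ v ∈ S ∧ u ≠ v ∧ ∃ D : Disk, IsEmptyDisk S u v D

/-- `u, v, w` are the vertices of a triangular face of the Delaunay triangulation of `S`, and `c` is
the center of the circumcircle of that triangle. -/
def IsDelaunayFace (S : Set Plane) (u v w c : Plane) : Prop :=
  u ∈ S ∧ v ∈ S ∧ w ∈ S ∧ u ≠ v ∧ u ≠ w ∧ v ≠ w ∧
    ∃ D : Disk, D.center = c ∧ u ∈ D.boundary ∧ v ∈ D.boundary ∧ w ∈ D.boundary ∧ S ∩ D.int = ∅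

/-- The segments `ab` and `cd` cross: they are not collinear and some point is in the relative
interior of both. -/
def SegmentsCross (a b c d : Plane) : Prop :=
  ¬ Collinear ℝ {a, b, c, d} ∧ (openSegment ℝ a b ∩ openSegment ℝ c d).Nonempty

/-- The Delaunay triangulation of `V`, as a graph with vertex set `V`. -/
def DT (V : Set Plane) : SimpleGraph V where
  Adj u v := IsDelaunayEdge V u v
  symm := ⟨fun u v ⟨hu, hv, hne, D, hD⟩ =>
    ⟨hv, hu, hne.symm, D, by rw [IsEmptyDisk, Set.pair_comm]; exact hD⟩⟩
  loopless := ⟨fun _ h => h.2.2.1 rfl⟩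

/-- The unit-disk graph of `V`. -/
def UDG (V : Set Plane) : SimpleGraph V where
  Adj u v := u ≠ v ∧ dist (u : Plane) (v : Plane) ≤ 1
  symm := ⟨fun _ _ h => ⟨h.1.symm, by rw [dist_comm]; exact h.2⟩⟩
  loopless := ⟨fun _ h => h.1 rfl⟩

/-- The intersection of the Delaunay triangulation and the unit-disk graph. -/
def UDel (V : Set Plane) : SimpleGraph V := DT V ⊓ UDG V

namespace PLDG

/-- `N_v`, the points of `V` within distance one of `v` (including `v`). -/
def nbhd (V : Set Plane) (v : Plane) : Set Plane := {u | u ∈ V ∧ dist u v ≤ 1}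

/-- The centers broadcast by `v` (together with `v` itself): the circumcenters of the triangular
faces `Δ(u, v, w)` of the Delaunay triangulation of `N_v` whose angle at `v` exceeds `π / 3`. -/
def broadcast (V : Set Plane) (v : Plane) : Set Plane :=
  {c | ∃ u w, IsDelaunayFace (nbhd V v) u v w c ∧ Real.pi / 3 < ∠ u v w}

/-- The pairs `(x, c)` such that `v` receives the center `c` from `x`: a broadcast of `x` reaches
exactly the points of `V` within distance one of `x`. -/
def received (V : Set Plane) (v : Plane) : Set (Plane × Plane) :=
  {m | m.1 ∈ V ∧ dist m.1 v ≤ 1 ∧ m.2 ∈ broadcast V m.1}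

/-- The circle with center `c` through `x`. -/
def circle (x c : Plane) : Set Plane := Metric.sphere c (dist c x)

/-- The part of the circle with center `c` through `x` outside the closed unit disk around `v`. -/
def arc (v x c : Plane) : Set Plane := circle x c \ Metric.closedBall v 1

/-- The circle with center `c` through `x` contains exactly two points of `N_v`, namely `x` and the
other point `p`. -/
def ExactlyTwo (V : Set Plane) (v x c p : Plane) : Prop :=
  p ≠ x ∧ nbhd V v ∩ circle x c = {x, p}

/-- The points that may be chosen as `z'`. -/
def candidates (v x c p : Plane) : Set Plane :=
  {z | z ∈ arc v x c ∧ (dist x z ≤ 1 ∨ dist p z ≤ 1)}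

/-- One way of making all the arbitrary choices in an execution of the algorithm. When `v` treats
the center `c` received from `x`, it uses the point `z v x c` as `z'` and, for each edge `(v, y)`,
the disk `del v x c y` as `Del_v(v, y)`. -/
structure Choices (V : Set Plane) where
  z : Plane → Plane → Plane → Plane
  z_mem : ∀ v ∈ V, ∀ x c p, (x, c) ∈ received V v → ExactlyTwo V v x c p →
    z v x c ∈ candidates v x c p
  del : Plane → Plane → Plane → Plane → Disk
  del_empty : ∀ v ∈ V, ∀ x c y, (x, c) ∈ received V v → IsDelaunayEdge (nbhd V v) v y →
    IsEmptyDisk (nbhd V v) v y (del v x c y)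

/-- When treating the center `c` received from `x`, the point `v` removes the edge `(v, y)`. -/
def Removes {V : Set Plane} (χ : Choices V) (v x c y : Plane) : Prop :=
  ∃ p, ExactlyTwo V v x c p ∧ arc v x c ⊆ (χ.del v x c y).int ∧
    (SegmentsCross v y x (χ.z v x c) ∨ SegmentsCross v y p (χ.z v x c))

/-- The edge set `E(v)` at the end of the algorithm: the edges incident on `v` of the Delaunay
triangulation of `N_v` that are not removed when treating any of the received centers. -/
def edges {V : Set Plane} (χ : Choices V) (v : V) : Set (Sym2 V) :=
  {e | ∃ y : V, e = s(v, y) ∧ IsDelaunayEdge (nbhd V v) v y ∧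
    ∀ x c, (x, c) ∈ received V v → ¬ Removes χ v x c y}

/-- The graph with vertex set `V` and edge set `⋃ v, E(v)`, for the choices `χ`. -/
def graph {V : Set Plane} (χ : Choices V) : SimpleGraph V :=
  SimpleGraph.fromEdgeSet (⋃ v : V, edges χ v)

/-- The choices that the algorithm has to make can always be made. -/
theorem candidates_nonempty {V : Set Plane} {v x c p : Plane} (hm : (x, c) ∈ received V v)
    (hp : ExactlyTwo V v x c p) : (candidates v x c p).Nonempty := by
  obtain ⟨hxV, hxv, u, w, ⟨hu, hx, hw, hux, huw, hxw, D, rfl, huD, hxD, hwD, -⟩, -⟩ := hm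
  obtain ⟨hpx, hN⟩ := hp
  have hr : dist D.center x = D.radius := by rw [dist_comm]; exact hxD
  have key : ∀ t ∈ nbhd V x, t ∈ D.boundary →
      t ∈ candidates v x D.center p ∨ t ∈ ({x, p} : Set Plane) := by
    intro t ht htD
    have htc : t ∈ circle x D.center := by
      have h2 : dist t D.center = D.radius := htD
      rw [circle, hr]; exact h2
    by_cases h : dist t v ≤ 1
    · right; rw [← hN]; exact ⟨⟨ht.1, h⟩, htc⟩
    · left; exact ⟨⟨htc, h⟩, Or.inl (by rw [dist_comm]; exact ht.2)⟩
  rcases key u hu huD with h | h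
  · exact ⟨u, h⟩
  rcases key w hw hwD with h' | h'
  · exact ⟨w, h'⟩
  simp only [Set.mem_insert_iff, Set.mem_singleton_iff] at h h'
  rcases h with h | h
  · exact absurd h hux
  · rcases h' with h' | h'
    · exact absurd h'.symm hxw
    · exact absurd (h.trans h'.symm) huw

instance (V : Set Plane) : Nonempty (Choices V) := by
  classical
  have h1 : ∀ v x c, ∃ z, ∀ p, (x, c) ∈ received V v → ExactlyTwo V v x c p →
      z ∈ candidates v x c p := by
    intro v x c
    by_cases h : (x, c) ∈ received V v ∧ ∃ p, ExactlyTwo V v x c p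
    · obtain ⟨hm, p, hp⟩ := h
      obtain ⟨z, hz⟩ := candidates_nonempty hm hp
      refine ⟨z, fun p' _ hp' => ?_⟩
      have : p' ∈ ({x, p} : Set Plane) := by rw [← hp.2, hp'.2]; simp
      rcases this with h | h
      · exact absurd h hp'.1
      · rw [Set.mem_singleton_iff.1 h]; exact hz
    · exact ⟨0, fun p hm hp => absurd ⟨hm, p, hp⟩ h⟩
  have h2 : ∀ v y, ∃ D, IsDelaunayEdge (nbhd V v) v y → IsEmptyDisk (nbhd V v) v y D := by
    intro v y
    by_cases h : IsDelaunayEdge (nbhd V v) v y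
    · obtain ⟨D, hD⟩ := h.2.2.2
      exact ⟨D, fun _ => hD⟩
    · exact ⟨⟨0, 1, one_pos⟩, fun h' => absurd h' h⟩
  choose z hz using h1
  choose del hdel using h2
  exact ⟨⟨z, fun v _ x c p => hz v x c p, fun v _ _ y => del v y, fun v _ _ _ y _ => hdel v y⟩⟩

end PLDG

/-! Suppose `v` treats a center `c` received from `x`. General position forces `p` to be a vertex of
the face behind `c`, and the third vertex `w` lies on the circle, outside the unit disk of `v`. The
disk of the face has no point of `N_x` in its interior, so `v` is not inside the circle.

If `y` is not inside the circle either, a crossing makes `vy` cut it in two points, which lie in the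
unit disk of `v` and in the global Delaunay disk of `vy`. Each of these disks then contains one of
the two arcs between the points. But `z` and `w` avoid the first disk, `s` (that is, `x` or `p`) and
`w` avoid the second, and `w` is separated by the line either from `z` or from `s`
(`not_segmentsCross_of_outside`).

If `y` is inside, it is not in `N_x`, so `|yx| > 1`. The line `vy` enters the circle at `a` and
leaves it at `b`, beyond `y`. Every chord to `z` that meets the line is shown to meet it beyond `y`,
that is, between `b` and `y`. For `xz` and `xw` this follows from the quadrilateral inequality when
the chord has length at most one, and a longer `xz` is compared with `xw`. For `pz` a crossing would
put `y` between two points of the unit disk of `x`, or contradict an obtuse angle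
(`InsideConfig.chordRatio_P_lt`).

All orderings on the circle are read off a stereographic chart from `b`: a disk missing `b` traces
an interval of parameters, and so does the complement of a disk containing `b`. Positions on the
line are coefficients `k` on the ray from `b` to `a`, growing towards `v`. -/

/-! ### Stereographic coordinates on a circle -/

/-- The stereographic parametrization, from its point `b`, of the circle with center `b + e₁`. -/
noncomputable def chart (b e₁ e₂ : Plane) (s : ℝ) : Plane := b + (2 / (1 + s ^ 2)) • (e₁ + s • e₂)

/-- `e₁, e₂` is an orthogonal basis of the plane with vectors of equal length. -/
structure IsFrame (e₁ e₂ : Plane) : Prop where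
  ne_zero : e₁ ≠ 0
  norm_eq : ‖e₂‖ = ‖e₁‖
  inner_eq : inner ℝ e₁ e₂ = 0
  span : ∀ u : Plane, ∃ x y : ℝ, u = x • e₁ + y • e₂

theorem exists_isFrame {e₁ : Plane} (h : e₁ ≠ 0) : ∃ e₂, IsFrame e₁ e₂ := by
  have hn : 0 < e₁ 0 ^ 2 + e₁ 1 ^ 2 := by
    have h1 : 0 < ‖e₁‖ ^ 2 := by positivity
    rwa [EuclideanSpace.real_norm_sq_eq, Fin.sum_univ_two] at h1
  refine ⟨!₂[-e₁ 1, e₁ 0], h, ?_, ?_, fun u => ?_⟩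
  · rw [EuclideanSpace.norm_eq, EuclideanSpace.norm_eq]
    simp [Fin.sum_univ_two, add_comm]
  · simp [PiLp.inner_apply, Fin.sum_univ_two]
    ring
  · refine ⟨(u 0 * e₁ 0 + u 1 * e₁ 1) / (e₁ 0 ^ 2 + e₁ 1 ^ 2),
      (u 1 * e₁ 0 - u 0 * e₁ 1) / (e₁ 0 ^ 2 + e₁ 1 ^ 2), ?_⟩
    ext i
    fin_cases i <;> simp <;> field_simp <;> ring

namespace IsFrame

variable {b e₁ e₂ : Plane}

theorem neg (h : IsFrame e₁ e₂) : IsFrame e₁ (-e₂) where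
  ne_zero := h.ne_zero
  norm_eq := by rw [norm_neg, h.norm_eq]
  inner_eq := by rw [inner_neg_right, h.inner_eq, neg_zero]
  span u := by
    obtain ⟨x, y, rfl⟩ := h.span u
    exact ⟨x, -y, by simp⟩

theorem norm_comb_sq (h : IsFrame e₁ e₂) (x y : ℝ) :
    ‖x • e₁ + y • e₂‖ ^ 2 = (x ^ 2 + y ^ 2) * ‖e₁‖ ^ 2 := by
  rw [norm_add_sq_real, inner_smul_left, inner_smul_right, h.inner_eq, norm_smul, norm_smul,
    h.norm_eq, mul_pow, mul_pow]
  simp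
  ring

theorem comb_inj (h : IsFrame e₁ e₂) {x y x' y' : ℝ}
    (he : x • e₁ + y • e₂ = x' • e₁ + y' • e₂) : x = x' ∧ y = y' := by
  have h1 : (x - x') • e₁ + (y - y') • e₂ = 0 := by
    rw [sub_smul, sub_smul, ← sub_eq_zero.2 he]; abel
  have h2 := h.norm_comb_sq (x - x') (y - y')
  rw [h1, norm_zero] at h2
  have h3 : 0 < ‖e₁‖ ^ 2 := by have := norm_pos_iff.2 h.ne_zero; positivity
  have h4 : (x - x') ^ 2 + (y - y') ^ 2 = 0 := by
    rw [zero_pow two_ne_zero] at h2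
    exact (mul_eq_zero.1 h2.symm).resolve_right h3.ne'
  constructor <;> nlinarith [sq_nonneg (x - x'), sq_nonneg (y - y')]

/-- Every point of the circle other than `b` is in the image of the chart. -/
theorem exists_chart (h : IsFrame e₁ e₂) {t : Plane} (ht : dist t (b + e₁) = ‖e₁‖) (hb : t ≠ b) :
    ∃ s, t = chart b e₁ e₂ s := by
  obtain ⟨x, y, hxy⟩ := h.span (t - b)
  have ht' : t = b + (x • e₁ + y • e₂) := by rw [← hxy]; abel
  have h3 : 0 < ‖e₁‖ ^ 2 := by have := norm_pos_iff.2 h.ne_zero; positivity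
  have h4 : (x - 1) ^ 2 + y ^ 2 = 1 := by
    have h5 := h.norm_comb_sq (x - 1) y
    have h6 : (x - 1) • e₁ + y • e₂ = t - (b + e₁) := by rw [ht', sub_smul, one_smul]; abel
    rw [h6, ← dist_eq_norm, ht] at h5
    exact (mul_right_cancel₀ h3.ne' (by rw [one_mul]; exact h5)).symm
  have hx : 0 < x := by
    rcases lt_trichotomy x 0 with h0 | h0 | h0
    · nlinarith [sq_nonneg y]
    · subst h0
      have : y = 0 := by nlinarith [sq_nonneg y]
      subst this
      exact absurd (by simpa using ht') hb
    · exact h0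
  refine ⟨y / x, ?_⟩
  have h7 : 2 / (1 + (y / x) ^ 2) = x := by
    have : 1 + (y / x) ^ 2 = 2 / x := by field_simp; nlinarith
    rw [this]; field_simp
  rw [ht', chart, h7, smul_add, smul_smul, mul_div_cancel₀ _ hx.ne']

/-- After subtracting `ρ ^ 2 * (1 + s ^ 2)`, the power of the point with respect to a circle around
`e` is a quadratic in `s` whose leading coefficient is the power of `b`. -/
theorem dist_chart_sq (h : IsFrame e₁ e₂) (e : Plane) (s : ℝ) :
    dist (chart b e₁ e₂ s) e ^ 2 * (1 + s ^ 2) = dist b e ^ 2 * (1 + s ^ 2) +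
      4 * (inner ℝ (b - e) e₁ + s * inner ℝ (b - e) e₂) + 4 * ‖e₁‖ ^ 2 := by
  have h1 : chart b e₁ e₂ s - e = (b - e) + (2 / (1 + s ^ 2)) • ((1 : ℝ) • e₁ + s • e₂) := by
    rw [chart, one_smul]; abel
  rw [dist_eq_norm, h1, norm_add_sq_real, norm_smul, mul_pow, h.norm_comb_sq, inner_smul_right,
    inner_add_right, inner_smul_right, inner_smul_right, dist_eq_norm, Real.norm_eq_abs, sq_abs]
  have : (1 + s ^ 2) ≠ 0 := by positivity
  field_simp
  ring

/-- With `b` outside the disk the quadratic of `dist_chart_sq` is strictly convex, so the disk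
traces an interval. -/
theorem dist_chart_lt (h : IsFrame e₁ e₂) {e : Plane} {ρ s t u : ℝ} (hρ : 0 ≤ ρ)
    (hb : ρ < dist b e) (hst : s < t) (htu : t < u) (hs : dist (chart b e₁ e₂ s) e ≤ ρ)
    (hu : dist (chart b e₁ e₂ u) e ≤ ρ) : dist (chart b e₁ e₂ t) e < ρ := by
  have hs' : dist (chart b e₁ e₂ s) e ^ 2 ≤ ρ ^ 2 := by gcongr
  have hu' : dist (chart b e₁ e₂ u) e ^ 2 ≤ ρ ^ 2 := by gcongr
  have hb' : ρ ^ 2 < dist b e ^ 2 := by gcongr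
  refine lt_of_pow_lt_pow_left₀ 2 hρ ?_
  have es := h.dist_chart_sq (b := b) e s
  have et := h.dist_chart_sq (b := b) e t
  have eu := h.dist_chart_sq (b := b) e u
  set B := inner ℝ (b - e) e₁
  set B' := inner ℝ (b - e) e₂
  have ps : (dist b e ^ 2 - ρ ^ 2) * (1 + s ^ 2) + 4 * (B + s * B') + 4 * ‖e₁‖ ^ 2 ≤ 0 := by
    nlinarith [mul_le_mul_of_nonneg_right hs' (by positivity : 0 ≤ 1 + s ^ 2)]
  have pu : (dist b e ^ 2 - ρ ^ 2) * (1 + u ^ 2) + 4 * (B + u * B') + 4 * ‖e₁‖ ^ 2 ≤ 0 := by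
    nlinarith [mul_le_mul_of_nonneg_right hu' (by positivity : 0 ≤ 1 + u ^ 2)]
  have pt : (u - s) * ((dist b e ^ 2 - ρ ^ 2) * (1 + t ^ 2) + 4 * (B + t * B') + 4 * ‖e₁‖ ^ 2)
      < 0 := by
    have q1 := mul_nonneg (sub_nonneg.2 htu.le) (neg_nonneg.2 ps)
    have q2 := mul_nonneg (sub_nonneg.2 hst.le) (neg_nonneg.2 pu)
    have q3 := mul_pos (mul_pos (mul_pos (sub_pos.2 hb') (sub_pos.2 hst)) (sub_pos.2 htu))
      (sub_pos.2 (hst.trans htu))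
    nlinarith
  have pt' := (pos_iff_neg_of_mul_neg pt).1 (sub_pos.2 (hst.trans htu))
  have : (dist (chart b e₁ e₂ t) e ^ 2 - ρ ^ 2) * (1 + t ^ 2) < 0 := by nlinarith
  nlinarith [neg_of_mul_neg_left this (by positivity)]

/-- With `b` in the disk the quadratic is concave, so the complement of the disk traces an interval.
-/
theorem lt_dist_chart (h : IsFrame e₁ e₂) {e : Plane} {ρ s t u : ℝ} (hρ : 0 ≤ ρ)
    (hb : dist b e ≤ ρ) (hst : s < t) (htu : t < u) (hs : ρ < dist (chart b e₁ e₂ s) e)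
    (hu : ρ < dist (chart b e₁ e₂ u) e) : ρ < dist (chart b e₁ e₂ t) e := by
  have hs' : ρ ^ 2 < dist (chart b e₁ e₂ s) e ^ 2 := by gcongr
  have hu' : ρ ^ 2 < dist (chart b e₁ e₂ u) e ^ 2 := by gcongr
  have hb' : dist b e ^ 2 ≤ ρ ^ 2 := by gcongr
  refine lt_of_pow_lt_pow_left₀ 2 dist_nonneg ?_
  have es := h.dist_chart_sq (b := b) e s
  have et := h.dist_chart_sq (b := b) e t
  have eu := h.dist_chart_sq (b := b) e u
  set B := inner ℝ (b - e) e₁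
  set B' := inner ℝ (b - e) e₂
  have ps : 0 < (dist b e ^ 2 - ρ ^ 2) * (1 + s ^ 2) + 4 * (B + s * B') + 4 * ‖e₁‖ ^ 2 := by
    nlinarith [mul_lt_mul_of_pos_right hs' (by positivity : 0 < 1 + s ^ 2)]
  have pu : 0 < (dist b e ^ 2 - ρ ^ 2) * (1 + u ^ 2) + 4 * (B + u * B') + 4 * ‖e₁‖ ^ 2 := by
    nlinarith [mul_lt_mul_of_pos_right hu' (by positivity : 0 < 1 + u ^ 2)]
  have pt : 0 < (u - s) *
      ((dist b e ^ 2 - ρ ^ 2) * (1 + t ^ 2) + 4 * (B + t * B') + 4 * ‖e₁‖ ^ 2) := by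
    have q1 := mul_pos (sub_pos.2 htu) ps
    have q2 := mul_pos (sub_pos.2 hst) pu
    have q3 := mul_nonneg (mul_nonneg (mul_nonneg (sub_nonneg.2 hb') (sub_pos.2 hst).le)
      (sub_pos.2 htu).le) (sub_pos.2 (hst.trans htu)).le
    nlinarith
  have pt' := (pos_iff_pos_of_mul_pos pt).1 (sub_pos.2 (hst.trans htu))
  have : 0 < (dist (chart b e₁ e₂ t) e ^ 2 - ρ ^ 2) * (1 + t ^ 2) := by nlinarith
  nlinarith [pos_of_mul_pos_left this (by positivity)]

/-- Where the chord between the parameters `s < u` meets the ray from `b` of parameter `t`. -/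
noncomputable def _root_.chordRatio (t s u : ℝ) : ℝ := 2 / (1 + t ^ 2 + (t - s) * (u - t))

theorem chordRatio_mem_openSegment {t s u : ℝ} (hst : s < t) (htu : t < u) :
    b + chordRatio t s u • (e₁ + t • e₂) ∈
      openSegment ℝ (chart b e₁ e₂ s) (chart b e₁ e₂ u) := by
  have hsu := hst.trans htu
  have hd : 0 < 1 + t ^ 2 + (t - s) * (u - t) := by
    have := mul_pos (sub_pos.2 hst) (sub_pos.2 htu); positivity
  have h1 := sub_pos.2 hst
  have h2 := sub_pos.2 htu
  have h3 := sub_pos.2 hsu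
  -- The factors `1 + s ^ 2` and `1 + u ^ 2` cancel the denominators of the chart; what remains is
  -- `t` as a convex combination of `s` and `u`.
  have hsum : (u - t) * (1 + s ^ 2) / ((u - s) * (1 + t ^ 2 + (t - s) * (u - t))) +
      (t - s) * (1 + u ^ 2) / ((u - s) * (1 + t ^ 2 + (t - s) * (u - t))) = 1 := by
    field_simp; ring
  refine ⟨_, _, by positivity, by positivity, hsum, ?_⟩
  set A := (u - t) * (1 + s ^ 2) / ((u - s) * (1 + t ^ 2 + (t - s) * (u - t))) with hA
  set A' := (t - s) * (1 + u ^ 2) / ((u - s) * (1 + t ^ 2 + (t - s) * (u - t))) with hA'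
  have e1 : A * (2 / (1 + s ^ 2)) + A' * (2 / (1 + u ^ 2)) = chordRatio t s u := by
    rw [hA, hA', chordRatio]; field_simp; ring
  have e2 : A * (2 / (1 + s ^ 2)) * s + A' * (2 / (1 + u ^ 2)) * u = chordRatio t s u * t := by
    rw [hA, hA', chordRatio]; field_simp; ring
  calc A • chart b e₁ e₂ s + A' • chart b e₁ e₂ u
      = (A + A') • b + ((A * (2 / (1 + s ^ 2)) + A' * (2 / (1 + u ^ 2))) • e₁ +
        (A * (2 / (1 + s ^ 2)) * s + A' * (2 / (1 + u ^ 2)) * u) • e₂) := by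
        simp only [chart]; module
    _ = _ := by rw [hsum, e1, e2]; module

/-- A ray from `b` that meets the chord between two points has its parameter between theirs. -/
theorem of_mem_openSegment (h : IsFrame e₁ e₂) {t s u k : ℝ} (hsu : s ≠ u)
    (hk : b + k • (e₁ + t • e₂) ∈ openSegment ℝ (chart b e₁ e₂ s) (chart b e₁ e₂ u)) :
    (s < t ∧ t < u ∨ u < t ∧ t < s) ∧ k = chordRatio t s u := by
  obtain ⟨A, A', hA, hA', hsum, he⟩ := hk
  have e0 : A • chart b e₁ e₂ s + A' • chart b e₁ e₂ u
      = (A + A') • b + ((A * (2 / (1 + s ^ 2)) + A' * (2 / (1 + u ^ 2))) • e₁ +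
        (A * (2 / (1 + s ^ 2)) * s + A' * (2 / (1 + u ^ 2)) * u) • e₂) := by
    simp only [chart]; module
  rw [e0, hsum, one_smul, smul_add, smul_smul] at he
  obtain ⟨e1, e2⟩ := h.comb_inj (add_left_cancel he)
  set K := A * (2 / (1 + s ^ 2)) with hK
  set K' := A' * (2 / (1 + u ^ 2)) with hK'
  have pK : 0 < K := by positivity
  have pK' : 0 < K' := by positivity
  have e3 : K * (t - s) = K' * (u - t) := by rw [← e1] at e2; linarith
  have hor : s < t ∧ t < u ∨ u < t ∧ t < s := by
    rcases lt_trichotomy s t with h1 | h1 | h1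
    · left
      refine ⟨h1, ?_⟩
      have := mul_pos pK (sub_pos.2 h1)
      rw [e3] at this
      linarith [pos_of_mul_pos_right this pK'.le]
    · subst h1
      have : u - s = 0 := by
        have h5 : K' * (u - s) = 0 := by rw [← e3]; ring
        exact (mul_eq_zero.1 h5).resolve_left pK'.ne'
      exact absurd (by linarith) hsu
    · right
      refine ⟨?_, h1⟩
      have := mul_neg_of_pos_of_neg pK (sub_neg.2 h1)
      rw [e3] at this
      linarith [neg_of_mul_neg_right this pK'.le]
  refine ⟨hor, ?_⟩
  have hpos : 0 < (t - s) * (u - t) := by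
    rcases hor with ⟨h1, h2⟩ | ⟨h1, h2⟩
    · exact mul_pos (sub_pos.2 h1) (sub_pos.2 h2)
    · exact mul_pos_of_neg_of_neg (sub_neg.2 h2) (sub_neg.2 h1)
  have hs2 : K * (1 + s ^ 2) + K' * (1 + u ^ 2) = 2 := by
    have h5 : (1 + s ^ 2) ≠ 0 := by positivity
    have h6 : (1 + u ^ 2) ≠ 0 := by positivity
    rw [hK, hK']; field_simp; linarith
  rw [chordRatio, eq_div_iff (by positivity), ← e1, ← hs2]
  linear_combination (s + u) * e3

theorem chart_neg (s : ℝ) : chart b e₁ (-e₂) (-s) = chart b e₁ e₂ s := by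
  simp [chart]

/-- Seen from `b`, in the circle of center `b + e₁`, an arc `p z x` that is cut off by a chord
`p x` shorter than `x b` is obtuse. -/
theorem dist_chart_lt_dist (h : IsFrame e₁ e₂) {p z x : ℝ} (hpz : p < z) (hzx : z < x)
    (hd : dist (chart b e₁ e₂ x) (chart b e₁ e₂ p) < dist (chart b e₁ e₂ x) b) :
    dist (chart b e₁ e₂ p) (chart b e₁ e₂ z) < dist (chart b e₁ e₂ p) (chart b e₁ e₂ x) := by
  have h3 : 0 < ‖e₁‖ ^ 2 := by have := norm_pos_iff.2 h.ne_zero; positivity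
  have key : ∀ s u, dist (chart b e₁ e₂ s) (chart b e₁ e₂ u) ^ 2 =
      4 * (s - u) ^ 2 / ((1 + s ^ 2) * (1 + u ^ 2)) * ‖e₁‖ ^ 2 := by
    intro s u
    have e0 : chart b e₁ e₂ s - chart b e₁ e₂ u =
        (2 / (1 + s ^ 2) - 2 / (1 + u ^ 2)) • e₁ +
          (2 / (1 + s ^ 2) * s - 2 / (1 + u ^ 2) * u) • e₂ := by
      simp only [chart]; module
    rw [dist_eq_norm, e0, h.norm_comb_sq]
    have h5 : (1 + s ^ 2) ≠ 0 := by positivity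
    have h6 : (1 + u ^ 2) ≠ 0 := by positivity
    field_simp
    ring
  have keyb : dist (chart b e₁ e₂ x) b ^ 2 = 4 / (1 + x ^ 2) * ‖e₁‖ ^ 2 := by
    have e0 : chart b e₁ e₂ x - b = (2 / (1 + x ^ 2)) • e₁ + (2 / (1 + x ^ 2) * x) • e₂ := by
      simp only [chart]; module
    rw [dist_eq_norm, e0, h.norm_comb_sq]
    have h5 : (1 + x ^ 2) ≠ 0 := by positivity
    field_simp
    ring
  have hd2 : dist (chart b e₁ e₂ x) (chart b e₁ e₂ p) ^ 2 < dist (chart b e₁ e₂ x) b ^ 2 := by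
    gcongr
  -- This is the hypothesis on chords in terms of parameters; it makes the angle at `b` over `px`
  -- acute, hence the opposite angle at `z` obtuse.
  have hA : (x - p) ^ 2 < 1 + p ^ 2 := by
    rw [key, keyb] at hd2
    have := lt_of_mul_lt_mul_right hd2 h3.le
    rw [div_lt_div_iff₀ (by positivity) (by positivity)] at this
    have h7 : 4 * (1 + x ^ 2) * (x - p) ^ 2 < 4 * (1 + x ^ 2) * (1 + p ^ 2) := by linarith
    exact lt_of_mul_lt_mul_left h7 (by positivity)
  refine lt_of_pow_lt_pow_left₀ 2 dist_nonneg ?_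
  rw [key, key]
  refine mul_lt_mul_of_pos_right ?_ h3
  rw [div_lt_div_iff₀ (by positivity) (by positivity)]
  have hPA : |p * (x - p)| < 1 + p ^ 2 := by
    refine abs_lt_of_sq_lt_sq ?_ (by positivity)
    nlinarith [sq_nonneg p, mul_le_mul_of_nonneg_left hA.le (sq_nonneg p)]
  -- Times `x - z`, this is `(x - p) ^ 2 * (1 + z ^ 2) - (z - p) ^ 2 * (1 + x ^ 2)`.
  have h8 : 0 < (x - p + (z - p)) * (1 + p ^ 2) + 2 * (p * (x - p)) * (z - p) := by
    have h9 := mul_pos (sub_pos.2 hpz) (sub_pos.2 (neg_lt.1 (abs_lt.1 hPA).1))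
    have h10 := mul_pos (sub_pos.2 hzx) (by positivity : 0 < 1 + p ^ 2)
    nlinarith
  have h11 := mul_pos (mul_pos (sub_pos.2 hzx) h8) (by positivity : 0 < 1 + p ^ 2)
  nlinarith

end IsFrame

/-! ### Distance inequalities and chords met by a ray -/

theorem dist_le_of_mem_segment {m₁ m₂ y x : Plane} {ρ : ℝ} (hy : y ∈ segment ℝ m₁ m₂)
    (h₁ : dist m₁ x ≤ ρ) (h₂ : dist m₂ x ≤ ρ) : dist y x ≤ ρ :=
  (convex_closedBall x ρ).segment_subset (Metric.mem_closedBall.2 h₁)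
    (Metric.mem_closedBall.2 h₂) hy

/-- In a convex quadrilateral the diagonals are together at least as long as two opposite sides. -/
theorem dist_add_dist_le_of_mem_segments {x w v y m : Plane} (h₁ : m ∈ segment ℝ x w)
    (h₂ : m ∈ segment ℝ v y) : dist y x + dist w v ≤ dist w x + dist y v := by
  have e₁ := dist_add_dist_of_mem_segment h₁
  have e₂ := dist_add_dist_of_mem_segment h₂
  have t₁ := dist_triangle y m x
  have t₂ := dist_triangle w m v
  rw [dist_comm w m, dist_comm m v] at t₂
  rw [dist_comm y m, dist_comm m x] at t₁
  rw [dist_comm w x, dist_comm y v]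
  linarith

theorem mem_segment_ray {b u : Plane} {k₁ k₂ k₃ : ℝ} (h₁ : k₁ ≤ k₂) (h₂ : k₂ ≤ k₃) :
    b + k₂ • u ∈ segment ℝ (b + k₁ • u) (b + k₃ • u) := by
  have h : k₂ ∈ segment ℝ k₁ k₃ := by rw [segment_eq_Icc (h₁.trans h₂)]; exact ⟨h₁, h₂⟩
  obtain ⟨c, d, hc, hd, hcd, rfl⟩ := h
  refine ⟨c, d, hc, hd, hcd, ?_⟩
  calc c • (b + k₁ • u) + d • (b + k₃ • u) = (c + d) • b + (c • k₁ + d • k₃) • u := by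
        simp only [smul_eq_mul]; module
    _ = _ := by rw [hcd, one_smul]

theorem chordRatio_le {t s u : ℝ} (hst : s < t) (htu : t < u) :
    chordRatio t s u ≤ 2 / (1 + t ^ 2) := by
  have := mul_pos (sub_pos.2 hst) (sub_pos.2 htu)
  exact div_le_div_of_nonneg_left zero_le_two (by positivity) (by linarith)

/-- Moving an endpoint of the chord along the circle towards `b` moves its crossing with the ray
towards `b`. -/
theorem chordRatio_lt {t s u u' : ℝ} (hst : s < t) (htu : t < u) (huu' : u < u') :
    chordRatio t s u' < chordRatio t s u := by
  have := mul_pos (sub_pos.2 hst) (sub_pos.2 htu)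
  have := sub_pos.2 hst
  rw [chordRatio, chordRatio]
  gcongr

/-- If a ray from `v` crosses the segments `pz` and then `px`, with `x` and `p` within distance one
of `v` and `z` not, then `px` is not longer than `pz`. -/
theorem dist_le_of_ray_crosses {v p x z q r : Plane} {κ : ℝ} (hκ : 1 < κ)
    (hr : r - v = κ • (q - v)) (hq : q ∈ openSegment ℝ p z) (hrx : r ∈ openSegment ℝ p x)
    (hx : dist x v ≤ 1) (hp : dist p v ≤ 1) (hz : 1 < dist z v) : dist p x ≤ dist p z := by
  obtain ⟨A, A', hA, hA', hAA, rfl⟩ := hq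
  obtain ⟨M, M', hM, hM', hMM, rfl⟩ := hrx
  have e1 : M' • (x - v) = (κ * A') • (z - v) + (κ * A - M) • (p - v) := by
    have e2 : M • p + M' • x - v = M • (p - v) + M' • (x - v) := by
      calc _ = M • p + M' • x - (M + M') • v := by rw [hMM, one_smul]
        _ = _ := by module
    have e3 : A • p + A' • z - v = A • (p - v) + A' • (z - v) := by
      calc _ = A • p + A' • z - (A + A') • v := by rw [hAA, one_smul]
        _ = _ := by module
    rw [e2, e3] at hr
    calc M' • (x - v) = (M • (p - v) + M' • (x - v)) - M • (p - v) := by abel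
      _ = _ := by rw [hr]; module
  have hκ0 : 0 < κ := by linarith
  -- The sign decides whether the ray from `v` through `x` meets `pz`. If not, the triangle
  -- inequality gives `κ * A' * dist z v ≤ 1 - κ * A < κ * A'`, against `1 < dist z v`.
  rcases le_or_gt (κ * A - M) 0 with he | he
  · exfalso
    have e4 : (κ * A') • (z - v) = M' • (x - v) + (M - κ * A) • (p - v) := by
      rw [e1]; module
    have e5 : κ * A' * dist z v ≤ M' * dist x v + (M - κ * A) * dist p v := by
      calc κ * A' * dist z v = ‖(κ * A') • (z - v)‖ := by
            rw [norm_smul, dist_eq_norm, Real.norm_eq_abs, abs_of_pos (by positivity)]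
        _ ≤ ‖M' • (x - v)‖ + ‖(M - κ * A) • (p - v)‖ := by rw [e4]; exact norm_add_le _ _
        _ = _ := by
            rw [norm_smul, norm_smul, dist_eq_norm, dist_eq_norm, Real.norm_eq_abs,
              Real.norm_eq_abs, abs_of_pos hM', abs_of_nonneg (by linarith)]
    have e6 : M' * dist x v ≤ M' := mul_le_of_le_one_right hM'.le hx
    have e7 : (M - κ * A) * dist p v ≤ M - κ * A := mul_le_of_le_one_right (by linarith) hp
    have e8 : κ * A' < κ * A' * dist z v := lt_mul_of_one_lt_right (by positivity) hz
    have e9 : κ * A + κ * A' = κ := by rw [← mul_add, hAA, mul_one]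
    linarith
  · have hS : κ * A' + (κ * A - M) = κ - M := by linear_combination κ * hAA
    have hS0 : M' < κ - M := by linarith
    have hS1 : 0 < κ - M := by linarith
    -- The segments `vx` and `pz` meet here, so they are diagonals, and `px` and `zv` are opposite
    -- sides.
    have m1 : v + (M' / (κ - M)) • (x - v) ∈ segment ℝ v x := by
      rw [segment_eq_image']
      exact ⟨_, ⟨by positivity, by rw [div_le_one hS1]; exact hS0.le⟩, rfl⟩
    have m2 : v + (M' / (κ - M)) • (x - v) ∈ segment ℝ p z := by
      refine ⟨(κ * A - M) / (κ - M), κ * A' / (κ - M), by positivity, by positivity, ?_, ?_⟩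
      · rw [← add_div, add_comm, hS, div_self hS1.ne']
      · calc _ = (κ - M)⁻¹ • ((κ * A' + (κ * A - M)) • v + M' • (x - v)) := by
              rw [e1]; simp only [div_eq_inv_mul]; module
          _ = _ := by
              rw [hS, smul_add, inv_smul_smul₀ hS1.ne', smul_smul, div_eq_inv_mul]
    have := dist_add_dist_le_of_mem_segments m2 m1
    rw [dist_comm x p, dist_comm z p] at this
    linarith

/-! ### The case of `y` inside the circle, in coordinates -/

/-- A configuration on the circle with center `b + e₁`. The points `x`, `p`, `w`, `z` of the circle
have the parameters `X`, `P`, `W`, `Z`; the line through `v` and `y` meets the circle in `b` and in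
the point with parameter `α`, and the latter separates `v`, outside the circle, from `y`, inside.
Some disk contains that point, `w` and `z` but neither `b` nor, in its interior, `x` or `p`. -/
structure InsideConfig (b e₁ e₂ v y : Plane) (α X P W Z kv ky : ℝ) : Prop where
  frame : IsFrame e₁ e₂
  hv : v = b + kv • (e₁ + α • e₂)
  hy : y = b + ky • (e₁ + α • e₂)
  le_kv : 2 / (1 + α ^ 2) ≤ kv
  px : dist (chart b e₁ e₂ P) (chart b e₁ e₂ X) ≤ 1
  wx : dist (chart b e₁ e₂ W) (chart b e₁ e₂ X) ≤ 1
  bx : 1 < dist b (chart b e₁ e₂ X)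
  yx : 1 < dist y (chart b e₁ e₂ X)
  xv : dist (chart b e₁ e₂ X) v ≤ 1
  pv : dist (chart b e₁ e₂ P) v ≤ 1
  wv : 1 < dist (chart b e₁ e₂ W) v
  zv : 1 < dist (chart b e₁ e₂ Z) v
  yv : dist y v ≤ 1
  av : dist (chart b e₁ e₂ α) v ≤ 1
  ne : X ≠ α
  disk : ∃ e ρ, 0 ≤ ρ ∧ ρ < dist b e ∧ dist (chart b e₁ e₂ α) e ≤ ρ ∧
    dist (chart b e₁ e₂ W) e < ρ ∧ dist (chart b e₁ e₂ Z) e < ρ ∧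
    ρ ≤ dist (chart b e₁ e₂ X) e ∧ ρ ≤ dist (chart b e₁ e₂ P) e

namespace InsideConfig

variable {b e₁ e₂ v y : Plane} {α X P W Z kv ky : ℝ}

/-- Reflection in the line `vy`, which lets the chord lemmas assume that `z` has the larger
parameter. -/
theorem neg (h : InsideConfig b e₁ e₂ v y α X P W Z kv ky) :
    InsideConfig b e₁ (-e₂) v y (-α) (-X) (-P) (-W) (-Z) kv ky where
  frame := h.frame.neg
  hv := by rw [neg_smul_neg]; exact h.hv
  hy := by rw [neg_smul_neg]; exact h.hy
  le_kv := by rw [neg_sq]; exact h.le_kv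
  px := by simpa only [IsFrame.chart_neg] using h.px
  wx := by simpa only [IsFrame.chart_neg] using h.wx
  bx := by simpa only [IsFrame.chart_neg] using h.bx
  yx := by simpa only [IsFrame.chart_neg] using h.yx
  xv := by simpa only [IsFrame.chart_neg] using h.xv
  pv := by simpa only [IsFrame.chart_neg] using h.pv
  wv := by simpa only [IsFrame.chart_neg] using h.wv
  zv := by simpa only [IsFrame.chart_neg] using h.zv
  yv := h.yv
  av := by simpa only [IsFrame.chart_neg] using h.av
  ne := fun h' => h.ne (neg_injective h')
  disk := by simpa only [IsFrame.chart_neg] using h.disk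

/-- The segment `vy` does not cross a segment `xt` with `|xt| ≤ 1 < |vt|`. -/
theorem chordRatio_lt_ky (h : InsideConfig b e₁ e₂ v y α X P W Z kv ky) {T : ℝ}
    (hT : X < α ∧ α < T ∨ T < α ∧ α < X)
    (hx : dist (chart b e₁ e₂ T) (chart b e₁ e₂ X) ≤ 1) (hv : 1 < dist (chart b e₁ e₂ T) v) :
    chordRatio α X T < ky := by
  by_contra! hk
  have key : b + chordRatio α X T • (e₁ + α • e₂) ∈
        segment ℝ (chart b e₁ e₂ X) (chart b e₁ e₂ T) ∧ chordRatio α X T ≤ 2 / (1 + α ^ 2) := by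
    rcases hT with ⟨h1, h2⟩ | ⟨h1, h2⟩
    · exact ⟨openSegment_subset_segment _ _ _ (IsFrame.chordRatio_mem_openSegment h1 h2),
        chordRatio_le h1 h2⟩
    · have e : chordRatio α X T = chordRatio α T X := by rw [chordRatio, chordRatio]; ring_nf
      rw [e, segment_symm]
      exact ⟨openSegment_subset_segment _ _ _ (IsFrame.chordRatio_mem_openSegment h1 h2),
        chordRatio_le h1 h2⟩
  have h2 : b + chordRatio α X T • (e₁ + α • e₂) ∈ segment ℝ v y := by
    rw [segment_symm, h.hv, h.hy]
    exact mem_segment_ray hk (key.2.trans h.le_kv)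
  -- If the segments met, opposite sides of total length more than 2 would be bounded by diagonals
  -- of total length at most 2.
  have := dist_add_dist_le_of_mem_segments key.1 h2
  linarith [h.yx, h.yv]

/-- Three disks locate `w`: the one of `disk` contains `w` and `a` but not `S` in its interior, so
`S < W`; the unit disk of `x` contains `S` and `w` but neither `z` nor `b`, so `W < Z`; the unit
disk of `v` contains `S` and `a` but neither `w` nor `z`, so `α < W`, whether or not it contains
`b`. -/
theorem W_mem_Ioo (h : InsideConfig b e₁ e₂ v y α X P W Z kv ky) {S : ℝ} (hS : S = X ∨ S = P)
    (hSα : S < α) (hαZ : α < Z) (hzx : 1 < dist (chart b e₁ e₂ Z) (chart b e₁ e₂ X)) :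
    α < W ∧ W < Z := by
  obtain ⟨e, ρ, hρ, hb, ha, hw, hz, hx, hp⟩ := h.disk
  have hsE : ρ ≤ dist (chart b e₁ e₂ S) e := by rcases hS with rfl | rfl <;> assumption
  have hsx : dist (chart b e₁ e₂ S) (chart b e₁ e₂ X) ≤ 1 := by
    rcases hS with rfl | rfl
    · simp
    · exact h.px
  have hsv : dist (chart b e₁ e₂ S) v ≤ 1 := by
    rcases hS with rfl | rfl
    · exact h.xv
    · exact h.pv
  have hSW : S < W := by
    by_contra! hWS
    rcases hWS.lt_or_eq with h1 | rfl
    · linarith [h.frame.dist_chart_lt hρ hb h1 hSα hw.le ha]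
    · linarith
  have hWZ : W < Z := by
    by_contra! hZW
    rcases hZW.lt_or_eq with h1 | rfl
    · linarith [h.frame.dist_chart_lt zero_le_one h.bx (hSα.trans hαZ) h1 hsx h.wx]
    · linarith [h.wx]
  refine ⟨?_, hWZ⟩
  by_contra! hWα
  rcases hWα.lt_or_eq with h1 | rfl
  · rcases le_or_gt (dist b v) 1 with hbv | hbv
    · linarith [h.frame.lt_dist_chart zero_le_one hbv h1 hαZ h.wv h.zv, h.av]
    · linarith [h.frame.dist_chart_lt zero_le_one hbv hSW h1 hsv h.av, h.wv]
  · linarith [h.wv, h.av]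

/-- If `xz` is longer than one, `w` lies between `a` and `z`, and `xz` meets the line nearer to `b`
than the short chord `xw`. -/
theorem chordRatio_X_lt (h : InsideConfig b e₁ e₂ v y α X P W Z kv ky) (hX : X < α)
    (hZ : α < Z) : chordRatio α X Z < ky := by
  rcases le_or_gt (dist (chart b e₁ e₂ Z) (chart b e₁ e₂ X)) 1 with hzx | hzx
  · exact h.chordRatio_lt_ky (Or.inl ⟨hX, hZ⟩) hzx h.zv
  · obtain ⟨h1, h2⟩ := h.W_mem_Ioo (Or.inl rfl) hX hZ hzx
    exact (chordRatio_lt hX h1 h2).trans (h.chordRatio_lt_ky (Or.inl ⟨hX, h1⟩) h.wx h.wv)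

theorem chordRatio_P_lt (h : InsideConfig b e₁ e₂ v y α X P W Z kv ky) (hP : P < α)
    (hZ : α < Z) (hv : chordRatio α P Z < kv) : chordRatio α P Z < ky := by
  by_contra! hk
  obtain ⟨e, ρ, hρ, hb, ha, hw, hz, hx, hp⟩ := h.disk
  -- `y` is not between two points of the unit disk around `x`
  have hball : ∀ k₁ k₂, k₁ ≤ ky → ky ≤ k₂ →
      dist (b + k₁ • (e₁ + α • e₂)) (chart b e₁ e₂ X) ≤ 1 →
      dist (b + k₂ • (e₁ + α • e₂)) (chart b e₁ e₂ X) ≤ 1 → False := by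
    intro k₁ k₂ h1 h2 d1 d2
    have := dist_le_of_mem_segment (mem_segment_ray h1 h2) d1 d2
    rw [← h.hy] at this
    linarith [h.yx]
  have hchord : ∀ s t, s < α → α < t → dist (chart b e₁ e₂ s) (chart b e₁ e₂ X) ≤ 1 →
      dist (chart b e₁ e₂ t) (chart b e₁ e₂ X) ≤ 1 →
      dist (b + chordRatio α s t • (e₁ + α • e₂)) (chart b e₁ e₂ X) ≤ 1 := by
    intro s t hs ht ds dt
    exact dist_le_of_mem_segment (openSegment_subset_segment _ _ _
      (IsFrame.chordRatio_mem_openSegment hs ht)) ds dt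
  have hxx : dist (chart b e₁ e₂ X) (chart b e₁ e₂ X) ≤ 1 := by simp
  -- The disk of `disk` covers the arc from `a` to `z`, so `x` is not on it.
  have hXZ : X < α ∨ Z < X := by
    by_contra! hc
    rcases hc.2.lt_or_eq with h1 | rfl
    · linarith [h.frame.dist_chart_lt hρ hb (hc.1.lt_of_ne h.ne.symm) h1 ha hz.le]
    · linarith [h.xv, h.zv]
  rcases le_or_gt (dist (chart b e₁ e₂ Z) (chart b e₁ e₂ X)) 1 with hzx | hzx
  · rcases hXZ with hX | hX
    · have h1 := h.chordRatio_lt_ky (Or.inl ⟨hX, hZ⟩) hzx h.zv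
      exact hball _ _ h1.le hk (hchord _ _ hX hZ hxx hzx) (hchord _ _ hP hZ h.px hzx)
    · rcases le_or_gt (chordRatio α P X) ky with h1 | h1
      · exact hball _ _ h1 hk (hchord _ _ hP (hZ.trans hX) h.px hxx) (hchord _ _ hP hZ h.px hzx)
      -- Now the ray from `v` meets `pz` and then `px`, both before `y`. The obtuse angle at `z`
      -- gives `|pz| < |px|`, the order of the crossings the opposite; `κ` is the ratio of their
      -- distances from `v`.
      · have h2 := chordRatio_lt hP hZ hX
        have h3 := h.frame.dist_chart_lt_dist (b := b) (hP.trans hZ) hX (by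
          rw [dist_comm, dist_comm _ b]; linarith [h.px, h.bx])
        refine absurd (dist_le_of_ray_crosses
          (κ := (kv - chordRatio α P X) / (kv - chordRatio α P Z)) (v := v) ?_ ?_
          (IsFrame.chordRatio_mem_openSegment (b := b) (e₁ := e₁) (e₂ := e₂) hP hZ)
          (IsFrame.chordRatio_mem_openSegment hP (hZ.trans hX)) h.xv h.pv h.zv) (not_le.2 h3)
        · rw [one_lt_div (sub_pos.2 hv)]; linarith
        · have e1 : ∀ k, b + k • (e₁ + α • e₂) - v = (-(kv - k)) • (e₁ + α • e₂) := by
            intro k; rw [h.hv]; module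
          rw [e1, e1, smul_smul, mul_neg, div_mul_cancel₀ _ (sub_pos.2 hv).ne']
  · obtain ⟨hW, hWZ⟩ := h.W_mem_Ioo (Or.inr rfl) hP hZ hzx
    have hX : X < α := by
      refine hXZ.resolve_right fun hX => ?_
      linarith [h.frame.dist_chart_lt zero_le_one h.bx (hP.trans hZ) hX h.px hxx]
    -- The chord `xw` meets the line beyond `y` and `pw` before it, and both lie in the unit disk of
    -- `x`.
    have h1 := h.chordRatio_lt_ky (Or.inl ⟨hX, hW⟩) h.wx h.wv
    exact hball _ _ h1.le (hk.trans (chordRatio_lt hP hW hWZ).le) (hchord _ _ hX hW hxx h.wx)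
      (hchord _ _ hP hW h.px h.wx)

/-- The segments from the points `x` and `p` to the point `z` do not cross `vy`. -/
theorem not_mem_openSegment (h : InsideConfig b e₁ e₂ v y α X P W Z kv ky) {S k : ℝ}
    (hS : S = X ∨ S = P) (hk : ky ≤ k) (hkv : k < kv) :
    b + k • (e₁ + α • e₂) ∉ openSegment ℝ (chart b e₁ e₂ S) (chart b e₁ e₂ Z) := by
  intro hmem
  have hSZ : S ≠ Z := by
    rintro rfl
    rcases hS with rfl | rfl
    · linarith [h.xv, h.zv]
    · linarith [h.pv, h.zv]
  obtain ⟨hor, rfl⟩ := h.frame.of_mem_openSegment hSZ hmem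
  rcases hor with ⟨h1, h2⟩ | ⟨h1, h2⟩
  · rcases hS with rfl | rfl
    · linarith [h.chordRatio_X_lt h1 h2]
    · linarith [h.chordRatio_P_lt h1 h2 hkv]
  · have e : chordRatio α S Z = chordRatio (-α) (-S) (-Z) := by
      rw [chordRatio, chordRatio]; ring_nf
    rw [e] at hk hkv
    rcases hS with rfl | rfl
    · linarith [h.neg.chordRatio_X_lt (neg_lt_neg h2) (neg_lt_neg h1)]
    · linarith [h.neg.chordRatio_P_lt (neg_lt_neg h2) (neg_lt_neg h1) hkv]

end InsideConfig

/-! ### Points on the line through `v` and `y` -/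

section Line

variable {v y c s z : Plane} {r t₁ t₂ : ℝ}

theorem exists_dist_eq_of_le_of_lt (ht : t₁ ≤ t₂) (h₁ : r ≤ dist (v + t₁ • (y - v)) c)
    (h₂ : dist (v + t₂ • (y - v)) c < r) :
    ∃ t, t₁ ≤ t ∧ t < t₂ ∧ dist (v + t • (y - v)) c = r := by
  have hcont : ContinuousOn (fun t : ℝ => dist (v + t • (y - v)) c) (Set.Icc t₁ t₂) := by fun_prop
  obtain ⟨t, ht, he⟩ := intermediate_value_Icc' ht hcont ⟨h₂.le, h₁⟩
  refine ⟨t, ht.1, ht.2.lt_of_ne ?_, he⟩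
  rintro rfl
  exact h₂.ne he

theorem exists_dist_eq_of_lt_of_le (ht : t₁ ≤ t₂) (h₁ : dist (v + t₁ • (y - v)) c < r)
    (h₂ : r ≤ dist (v + t₂ • (y - v)) c) :
    ∃ t, t₁ < t ∧ t ≤ t₂ ∧ dist (v + t • (y - v)) c = r := by
  have hcont : ContinuousOn (fun t : ℝ => dist (v + t • (y - v)) c) (Set.Icc t₁ t₂) := by fun_prop
  obtain ⟨t, ht, he⟩ := intermediate_value_Icc ht hcont ⟨h₁.le, h₂⟩
  refine ⟨t, ht.1.lt_of_ne ?_, ht.2, he⟩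
  rintro rfl
  exact h₁.ne he

theorem exists_le_dist_ray (hvy : v ≠ y) (c : Plane) (r : ℝ) :
    ∃ t : ℝ, 1 ≤ t ∧ r ≤ dist (v + t • (y - v)) c := by
  have hd : 0 < dist y v := dist_pos.2 hvy.symm
  refine ⟨max 1 ((r + dist v c) / dist y v), le_max_left _ _, ?_⟩
  set t := max 1 ((r + dist v c) / dist y v)
  have h1 : r + dist v c ≤ t * dist y v := (div_le_iff₀ hd).1 (le_max_right _ _)
  have h2 : dist (v + t • (y - v)) v = t * dist y v := by
    rw [dist_eq_norm, add_sub_cancel_left, norm_smul, dist_eq_norm, Real.norm_eq_abs,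
      abs_of_pos (zero_lt_one.trans_le (le_max_left _ _))]
  have h3 := dist_triangle_right (v + t • (y - v)) v c
  linarith

/-- A line that contains an inner point and an endpoint of a segment contains the other endpoint. -/
theorem exists_eq_of_mem_openSegment {τ t₀ : ℝ} (hs : s = v + t₀ • (y - v))
    (hq : v + τ • (y - v) ∈ openSegment ℝ s z) : ∃ t : ℝ, z = v + t • (y - v) := by
  obtain ⟨A, A', hA, hA', hAA, he⟩ := hq
  refine ⟨(τ - A * t₀) / A', ?_⟩
  have h1 : A' • z = A' • v + (τ - A * t₀) • (y - v) := by
    calc A' • z = (A • s + A' • z) - A • s := by abel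
      _ = (A + A') • v + τ • (y - v) - A • s := by rw [he, hAA, one_smul]
      _ = _ := by rw [hs]; module
  calc z = A'⁻¹ • A' • z := (inv_smul_smul₀ hA'.ne' z).symm
    _ = _ := by rw [h1, smul_add, inv_smul_smul₀ hA'.ne', smul_smul, div_eq_inv_mul]

theorem collinear_of_eq {t₁ t₂ : ℝ} (hs : s = v + t₁ • (y - v)) (hz : z = v + t₂ • (y - v)) :
    Collinear ℝ {v, y, s, z} := by
  rw [collinear_iff_of_mem (p₀ := v) (by simp)]
  refine ⟨y - v, fun p hp => ?_⟩
  simp only [Set.mem_insert_iff, Set.mem_singleton_iff] at hp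
  rcases hp with rfl | rfl | rfl | rfl
  · exact ⟨0, by simp⟩
  · exact ⟨1, by simp⟩
  · exact ⟨t₁, by rw [hs, vadd_eq_add, add_comm]⟩
  · exact ⟨t₂, by rw [hz, vadd_eq_add, add_comm]⟩

theorem SegmentsCross.exists_param (h : SegmentsCross v y s z) :
    ∃ τ : ℝ, 0 < τ ∧ τ < 1 ∧ v + τ • (y - v) ∈ openSegment ℝ s z ∧
      (∀ t : ℝ, s ≠ v + t • (y - v)) ∧ ∀ t : ℝ, z ≠ v + t • (y - v) := by
  obtain ⟨hcol, q, hq, hq'⟩ := h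
  rw [openSegment_eq_image'] at hq
  obtain ⟨τ, ⟨h0, h1⟩, rfl⟩ := hq
  refine ⟨τ, h0, h1, hq', fun t ht => ?_, fun t ht => ?_⟩
  · obtain ⟨t', ht'⟩ := exists_eq_of_mem_openSegment ht hq'
    exact hcol (collinear_of_eq ht ht')
  · rw [openSegment_symm] at hq'
    obtain ⟨t', ht'⟩ := exists_eq_of_mem_openSegment ht hq'
    exact hcol (collinear_of_eq ht' ht)

/-- Converts the parameter `t` from `v` to `y` into the coefficient on the ray from `b`, which
decreases in `t`. -/
theorem line_eq_ray {e₁ e₂ : Plane} {τa τb α : ℝ} (hab : τa < τb)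
    (ha : v + τa • (y - v) = chart (v + τb • (y - v)) e₁ e₂ α) (t : ℝ) :
    v + t • (y - v) = (v + τb • (y - v)) +
      ((τb - t) / (τb - τa) * (2 / (1 + α ^ 2))) • (e₁ + α • e₂) := by
  have h1 : (2 / (1 + α ^ 2)) • (e₁ + α • e₂) = (-(τb - τa)) • (y - v) := by
    calc _ = chart (v + τb • (y - v)) e₁ e₂ α - (v + τb • (y - v)) := by
          rw [chart, add_sub_cancel_left]
      _ = _ := by rw [← ha]; module
  have h2 : (τb - t) / (τb - τa) * -(τb - τa) = t - τb := by
    rw [mul_neg, div_mul_cancel₀ _ (sub_pos.2 hab).ne', neg_sub]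
  rw [mul_smul, h1, smul_smul, h2]
  module

theorem dist_line_le {t : ℝ} (h0 : 0 ≤ t) (h1 : t ≤ 1) {e : Plane} {ρ : ℝ} (hv : dist v e ≤ ρ)
    (hy : dist y e ≤ ρ) : dist (v + t • (y - v)) e ≤ ρ :=
  dist_le_of_mem_segment (by rw [segment_eq_image']; exact ⟨t, ⟨h0, h1⟩, rfl⟩) hv hy

theorem dist_lt_of_mem_openSegment {m₁ m₂ q : Plane} (h : q ∈ openSegment ℝ m₁ m₂)
    (hne : m₁ ≠ m₂) (h₁ : dist m₁ c ≤ r) (h₂ : dist m₂ c ≤ r) : dist q c < r := by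
  rcases eq_or_ne r 0 with rfl | hr
  · exact absurd ((dist_le_zero.1 h₁).trans (dist_le_zero.1 h₂).symm) hne
  have := (strictConvex_closedBall ℝ c r).openSegment_subset (Metric.mem_closedBall.2 h₁)
    (Metric.mem_closedBall.2 h₂) hne h
  rwa [interior_closedBall c hr, Metric.mem_ball] at this

end Line

/-! ### The two positions of `y` relative to the circle -/

section Cross

variable {c x p w z v y s : Plane} {r : ℝ}

/-- A segment with both endpoints outside a circle cannot cross a chord `sz` that ends outside the
disk around `v` if there is a disk through `v` and `y` that contains neither `s` nor the point `w`
of the circle, which is outside the disk around `v` as well. -/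
theorem not_segmentsCross_of_outside (hr : 0 < r) (hs : dist s c = r) (hw : dist w c = r)
    (hz : dist z c = r) (hv : r ≤ dist v c) (hy : r ≤ dist y c) (hyv : dist y v ≤ 1)
    (hwv : 1 < dist w v) (hzv : 1 < dist z v) (hsz : s ≠ z) {D : Disk} (hvD : v ∈ D.boundary)
    (hyD : y ∈ D.boundary) (hwD : D.radius < dist w D.center) (hsD : D.radius < dist s D.center) :
    ¬ SegmentsCross v y s z := by
  intro hcross
  obtain ⟨τ, h0, h1, hq, hs', hz'⟩ := hcross.exists_param
  have hqc : dist (v + τ • (y - v)) c < r := dist_lt_of_mem_openSegment hq hsz hs.le hz.le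
  obtain ⟨τa, ha0, haτ, hac⟩ := exists_dist_eq_of_le_of_lt h0.le (by simpa using hv) hqc
  obtain ⟨τb, hτb, hb1, hbc⟩ := exists_dist_eq_of_lt_of_le h1.le hqc (by simpa using hy)
  have hab : τa < τb := haτ.trans hτb
  have hvD' : dist v D.center ≤ D.radius := le_of_eq hvD
  have hyD' : dist y D.center ≤ D.radius := le_of_eq hyD
  have hvv : dist v v ≤ 1 := by simp
  have hav := dist_line_le ha0 (haτ.le.trans h1.le) hvv hyv
  have hbv := dist_line_le (h0.le.trans hτb.le) hb1 hvv hyv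
  have haD := dist_line_le ha0 (haτ.le.trans h1.le) hvD' hyD'
  have hbD := dist_line_le (h0.le.trans hτb.le) hb1 hvD' hyD'
  have hne : v + τa • (y - v) ≠ v + τb • (y - v) := by
    intro h
    have h2 : (τb - τa) • (y - v) = 0 := by
      rw [sub_smul, sub_eq_zero]; exact (add_left_cancel h).symm
    rcases smul_eq_zero.1 h2 with h3 | h3
    · linarith
    · rw [sub_eq_zero] at h3
      subst h3
      have h4 : dist y D.center = D.radius := hyD
      simp only [sub_self, smul_zero, add_zero] at hqc
      linarith
  have hray := fun e₁ e₂ α => line_eq_ray (v := v) (y := y) (e₁ := e₁) (e₂ := e₂) (α := α) hab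
  set a := v + τa • (y - v)
  set b := v + τb • (y - v)
  have hcb : ‖c - b‖ = r := by rw [← dist_eq_norm, dist_comm, hbc]
  obtain ⟨e₂, hF⟩ := exists_isFrame (e₁ := c - b) (by rw [← norm_pos_iff, hcb]; exact hr)
  have hchart : ∀ t, dist t c = r → t ≠ b → ∃ σ, t = chart b (c - b) e₂ σ := fun t ht htb =>
    hF.exists_chart (by rw [add_sub_cancel, hcb, ht]) htb
  obtain ⟨α, hα⟩ := hchart a hac hne
  obtain ⟨σ, rfl⟩ := hchart s hs (hs' _)
  obtain ⟨ζ, rfl⟩ := hchart z hz (hz' _)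
  obtain ⟨ω, rfl⟩ := hchart w hw (by rintro rfl; linarith)
  rw [hray _ _ _ hα τ] at hq
  rw [hα] at hav haD
  have hD := D.radius_pos.le
  -- On the side of `s`, `w` is separated from `z` and the unit disk of `v` gives the contradiction;
  -- on the side of `z`, it is separated from `s` and `D` does.
  rcases lt_trichotomy ω α with h | rfl | h
  · rcases (hF.of_mem_openSegment (by rintro rfl; exact hsz rfl) hq).1 with ⟨h2, h3⟩ | ⟨h2, h3⟩
    · linarith [hF.lt_dist_chart zero_le_one hbv h h3 hwv hzv]
    · linarith [hF.lt_dist_chart hD hbD h h3 hwD hsD]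
  · linarith
  · rcases (hF.of_mem_openSegment (by rintro rfl; exact hsz rfl) hq).1 with ⟨h2, h3⟩ | ⟨h2, h3⟩
    · linarith [hF.lt_dist_chart hD hbD h2 h hsD hwD]
    · linarith [hF.lt_dist_chart zero_le_one hbv h2 h hzv hwv]

/-- A segment `vy` from outside to inside of the circle through `x`, `p`, `w` does not cross a
chord `xz` or `pz` under the conditions on distances that hold when `v` treats the center of the
circle. -/
theorem not_segmentsCross_of_inside (hr : 0 < r) (hx : dist x c = r) (hp : dist p c = r)
    (hw : dist w c = r) (hz : dist z c = r) (hs : s = x ∨ s = p) (hv : r ≤ dist v c)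
    (hy : dist y c < r) (hpx : dist p x ≤ 1) (hwx : dist w x ≤ 1) (hxv : dist x v ≤ 1)
    (hpv : dist p v ≤ 1) (hwv : 1 < dist w v) (hzv : 1 < dist z v) (hyv : dist y v ≤ 1)
    (hyx : 1 < dist y x) {E : Disk} (hvE : v ∈ E.boundary) (hyE : y ∈ E.boundary)
    (hwE : w ∈ E.int) (hzE : z ∈ E.int) (hxE : x ∉ E.int) (hpE : p ∉ E.int) :
    ¬ SegmentsCross v y s z := by
  intro hcross
  obtain ⟨τ, h0, h1, hq, hs', hz'⟩ := hcross.exists_param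
  have hvy : v ≠ y := by rintro rfl; linarith
  have hvE' : dist v E.center = E.radius := hvE
  have hyE' : dist y E.center = E.radius := hyE
  have hwE' : dist w E.center < E.radius := hwE
  have hzE' : dist z E.center < E.radius := hzE
  have hxE' : E.radius ≤ dist x E.center := not_lt.1 hxE
  have hpE' : E.radius ≤ dist p E.center := not_lt.1 hpE
  have hvx : dist v x ≤ 1 := by rw [dist_comm]; exact hxv
  have hy' : dist (v + (1 : ℝ) • (y - v)) c < r := by simpa using hy
  obtain ⟨τa, ha0, ha1, hac⟩ := exists_dist_eq_of_le_of_lt zero_le_one (by simpa using hv) hy'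
  obtain ⟨M, hM1, hM⟩ := exists_le_dist_ray hvy c r
  obtain ⟨τb, hb1, -, hbc⟩ := exists_dist_eq_of_lt_of_le hM1 hy' hM
  have hab : τa < τb := ha1.trans hb1
  have hb0 : 0 < τb := zero_lt_one.trans hb1
  have hvv : dist v v ≤ 1 := by simp
  have hav := dist_line_le ha0 ha1.le hvv hyv
  have haE := dist_line_le ha0 ha1.le hvE'.le hyE'.le
  have hinj : ∀ t t' : ℝ, v + t • (y - v) = v + t' • (y - v) → t = t' := by
    intro t t' h
    exact smul_left_injective ℝ (sub_ne_zero.2 hvy.symm) (add_left_cancel h)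
  have hne : v + τa • (y - v) ≠ v + τb • (y - v) := fun h => hab.ne (hinj _ _ h)
  have hybv : y ∈ openSegment ℝ v (v + τb • (y - v)) := by
    rw [openSegment_eq_image']
    refine ⟨τb⁻¹, ⟨by positivity, inv_lt_one_of_one_lt₀ hb1⟩, ?_⟩
    simp only [add_sub_cancel_left]
    rw [inv_smul_smul₀ hb0.ne', add_sub_cancel]
  have hvb : v ≠ v + τb • (y - v) := fun h => hb0.ne (hinj 0 τb (by simpa using h))
  -- Otherwise strict convexity would put `y` in the interior of `E`.
  have hbE : E.radius < dist (v + τb • (y - v)) E.center := by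
    by_contra! h
    linarith [dist_lt_of_mem_openSegment hybv hvb hvE'.le h]
  have hbx : 1 < dist (v + τb • (y - v)) x := by
    by_contra! h
    linarith [dist_le_of_mem_segment (openSegment_subset_segment _ _ _ hybv) hvx h]
  -- If `a = v`, then `x = a` contradicts `|yv| ≤ 1 < |yx|`; otherwise `a` is in the interior of
  -- `E`, where `x` is not.
  have hxa : x ≠ v + τa • (y - v) := by
    rintro h
    rcases ha0.eq_or_lt with h2 | h2
    · rw [← h2, zero_smul, add_zero] at h
      rw [h] at hyx
      linarith
    · have h3 : v + τa • (y - v) ∈ openSegment ℝ v y := by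
        rw [openSegment_eq_image']; exact ⟨τa, ⟨h2, ha1⟩, rfl⟩
      rw [← h] at h3
      linarith [dist_lt_of_mem_openSegment h3 hvy hvE'.le hyE'.le]
  have hray := fun e₁ e₂ α => line_eq_ray (v := v) (y := y) (e₁ := e₁) (e₂ := e₂) (α := α) hab
  set a := v + τa • (y - v)
  set b := v + τb • (y - v)
  have hzb : z ≠ b := hz' _
  clear_value a b
  have hcb : ‖c - b‖ = r := by rw [← dist_eq_norm, dist_comm, hbc]
  obtain ⟨e₂, hF⟩ := exists_isFrame (e₁ := c - b) (by rw [← norm_pos_iff, hcb]; exact hr)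
  have hchart : ∀ t, dist t c = r → t ≠ b → ∃ σ, t = chart b (c - b) e₂ σ := fun t ht htb =>
    hF.exists_chart (by rw [add_sub_cancel, hcb, ht]) htb
  obtain ⟨α, hα⟩ := hchart a hac hne
  obtain ⟨X, hX⟩ := hchart x hx (by rintro rfl; simp at hbx; linarith)
  obtain ⟨P, hP⟩ := hchart p hp (by rintro rfl; linarith)
  obtain ⟨W, hW⟩ := hchart w hw (by rintro rfl; linarith)
  obtain ⟨Z, hZ⟩ := hchart z hz hzb
  have hd := sub_pos.2 hab
  have hcfg : InsideConfig b (c - b) e₂ v y α X P W Z ((τb - 0) / (τb - τa) * (2 / (1 + α ^ 2)))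
      ((τb - 1) / (τb - τa) * (2 / (1 + α ^ 2))) := by
    have h1 := hray (c - b) e₂ α hα 0
    have h2 := hray (c - b) e₂ α hα 1
    rw [zero_smul, add_zero] at h1
    rw [one_smul, add_sub_cancel] at h2
    refine ⟨hF, h1, h2, ?_, ?_, ?_, ?_, ?_, ?_, ?_, ?_, ?_, hyv, ?_, ?_, E.center, E.radius,
      E.radius_pos.le, hbE, ?_, ?_, ?_, ?_, ?_⟩
    · refine le_mul_of_one_le_left (by positivity) ?_
      rw [one_le_div hd]; linarith
    · rw [← hP, ← hX]; exact hpx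
    · rw [← hW, ← hX]; exact hwx
    · rw [← hX]; exact hbx
    · rw [← hX]; exact hyx
    · rw [← hX]; exact hxv
    · rw [← hP]; exact hpv
    · rw [← hW]; exact hwv
    · rw [← hZ]; exact hzv
    · rw [← hα]; exact hav
    · rintro rfl
      exact hxa (hX.trans hα.symm)
    · rw [← hα]; exact haE
    · rw [← hW]; exact hwE'
    · rw [← hZ]; exact hzE'
    · rw [← hX]; exact hxE'
    · rw [← hP]; exact hpE'
  have hS : ∃ S, s = chart b (c - b) e₂ S ∧ (S = X ∨ S = P) := by
    rcases hs with rfl | rfl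
    · exact ⟨X, hX, Or.inl rfl⟩
    · exact ⟨P, hP, Or.inr rfl⟩
  obtain ⟨S, hS, hS'⟩ := hS
  rw [hray _ _ _ hα τ, hS, hZ] at hq
  exact hcfg.not_mem_openSegment hS' (by gcongr) (by gcongr) hq

end Cross

/-! ### From the algorithm to the geometric cases -/

namespace PLDG

theorem isDelaunayEdge_nbhd {V : Set Plane} {v y : Plane} (h : IsDelaunayEdge V v y)
    (hyv : dist y v ≤ 1) : IsDelaunayEdge (nbhd V v) v y := by
  obtain ⟨hv, hy, hne, D, hD, hD'⟩ := h
  refine ⟨⟨hv, by simp⟩, ⟨hy, hyv⟩, hne, D, ?_, ?_⟩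
  · refine Set.Subset.antisymm (fun t ht => hD ▸ ⟨ht.1.1, ht.2⟩) (fun t ht => ?_)
    have h2 : t ∈ V ∩ D.boundary := hD ▸ ht
    refine ⟨⟨h2.1, ?_⟩, h2.2⟩
    rcases ht with rfl | rfl
    · simp
    · exact hyv
  · exact Set.eq_empty_of_forall_notMem fun t ht =>
      Set.eq_empty_iff_forall_notMem.1 hD' t ⟨ht.1.1, ht.2⟩

/-- The third vertex of the face with circumcenter `c`. -/
theorem exists_third_vertex {V : Set Plane} (hgp : InGeneralPosition V) {v x c p : Plane}
    (hm : (x, c) ∈ received V v) (hp : ExactlyTwo V v x c p) :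
    ∃ w ∈ nbhd V x, w ∈ arc v x c ∧ dist p x ≤ 1 ∧ 0 < dist c x ∧
      ∀ t ∈ nbhd V x, dist c x ≤ dist t c := by
  obtain ⟨hxV, hxv, u, w, ⟨hu, hx, hw, hux, huw, hxw, D, rfl, huD, hxD, hwD, hint⟩, -⟩ := hm
  obtain ⟨hpx, hN⟩ := hp
  have hr : dist D.center x = D.radius := by rw [dist_comm]; exact hxD
  have hpN : p ∈ nbhd V v ∩ circle x D.center := by rw [hN]; simp
  have hpD : p ∈ D.boundary := by have := hpN.2; rwa [circle, hr] at this
  have hout : ∀ t ∈ nbhd V x, dist D.center x ≤ dist t D.center := by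
    intro t ht
    by_contra! h
    rw [hr] at h
    exact Set.eq_empty_iff_forall_notMem.1 hint t ⟨ht, h⟩
  have harc : ∀ t ∈ nbhd V x, t ∈ D.boundary → t ≠ x → t ≠ p → t ∈ arc v x D.center := by
    intro t ht htD htx htp
    have htc : t ∈ circle x D.center := by rw [circle, hr]; exact htD
    refine ⟨htc, fun h => ?_⟩
    have : t ∈ ({x, p} : Set Plane) := hN ▸ ⟨⟨ht.1, h⟩, htc⟩
    rcases this with h | h
    · exact htx h
    · exact htp h
  have hr0 : 0 < dist D.center x := by rw [hr]; exact D.radius_pos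
  by_cases hpu : p = u
  · subst hpu
    exact ⟨w, hw, harc w hw hwD hxw.symm huw.symm, hu.2, hr0, hout⟩
  by_cases hpw : p = w
  · subst hpw
    exact ⟨u, hu, harc u hu huD hux (Ne.symm hpu), hw.2, hr0, hout⟩
  -- If `p` were not a vertex of the face, it would be a fourth point of `V` on its circumcircle.
  · refine absurd ⟨D.center, D.radius, ?_⟩ (hgp.not_cocircular u hu.1 x hxV w hw.1 p hpN.1.1
      hux huw (Ne.symm hpu) hxw hpx.symm (Ne.symm hpw))
    intro t ht
    simp only [Set.mem_insert_iff, Set.mem_singleton_iff] at ht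
    rcases ht with rfl | rfl | rfl | rfl <;> assumption

/-- No short edge of the Delaunay triangulation of `V` is removed by its endpoint `v`. -/
theorem not_removes {V : Set Plane} (hgp : InGeneralPosition V) (χ : Choices V) {v y x c : Plane}
    (h : IsDelaunayEdge V v y) (hyv : dist y v ≤ 1) (hm : (x, c) ∈ received V v) :
    ¬ Removes χ v x c y := by
  rintro ⟨p, hp, harc, hcross⟩
  obtain ⟨hEb, hEi⟩ := χ.del_empty v h.1 x c y hm (isDelaunayEdge_nbhd h hyv)
  have hz := (χ.z_mem v h.1 x c p hm hp).1
  obtain ⟨w, hwx, hw, hpx, hr, hout⟩ := exists_third_vertex hgp hm hp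
  set z := χ.z v x c
  set E := χ.del v x c y
  obtain ⟨hvV, hyV, hvy, D, hDb, hDi⟩ := h
  have hxN : x ∈ nbhd V v ∩ circle x c := by rw [hp.2]; simp
  have hpN : p ∈ nbhd V v ∩ circle x c := by rw [hp.2]; simp
  have hvE : v ∈ nbhd V v ∩ E.boundary := by rw [hEb]; simp
  have hyE : y ∈ nbhd V v ∩ E.boundary := by rw [hEb]; simp
  have hvD : v ∈ V ∩ D.boundary := by rw [hDb]; simp
  have hyD : y ∈ V ∩ D.boundary := by rw [hDb]; simp
  have hE : ∀ t ∈ nbhd V v, t ∉ E.int := fun t ht ht' =>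
    Set.eq_empty_iff_forall_notMem.1 hEi t ⟨ht, ht'⟩
  have hD : ∀ t ∈ V, t ≠ v → t ≠ y → D.radius < dist t D.center := by
    intro t ht htv hty
    by_contra! hle
    rcases hle.lt_or_eq with h2 | h2
    · exact Set.eq_empty_iff_forall_notMem.1 hDi t ⟨ht, h2⟩
    · have : t ∈ ({v, y} : Set Plane) := hDb ▸ ⟨ht, h2⟩
      rcases this with h3 | h3
      · exact htv h3
      · exact hty h3
  have hwv : 1 < dist w v := not_le.1 hw.2
  have hzv : 1 < dist z v := not_le.1 hz.2
  have hxv : dist x v ≤ 1 := hxN.1.2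
  have hpv : dist p v ≤ 1 := hpN.1.2
  have hvc : dist c x ≤ dist v c := hout v ⟨hvV, by rw [dist_comm]; exact hxv⟩
  have main : ∀ s, s = x ∨ s = p → ¬ SegmentsCross v y s z := by
    intro s hs hc
    -- The outer case uses the global disk `D`, the inner one the local disk `E`; that `E` covers
    -- the arc is needed only at `w` and `z`.
    rcases le_or_gt (dist c x) (dist y c) with hyc | hyc
    · obtain ⟨τ, -, -, -, hs', -⟩ := hc.exists_param
      have hsN : s ∈ nbhd V v ∩ circle x c := by rcases hs with rfl | rfl <;> assumption
      have hsD := hD s hsN.1.1 (fun h => hs' 0 (by simpa using h))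
        (fun h => hs' 1 (by simpa using h))
      have hwD := hD w hwx.1 (by rintro rfl; simp at hwv; linarith) (by rintro rfl; linarith)
      refine not_segmentsCross_of_outside hr hsN.2 hw.1 hz.1 hvc hyc hyv hwv hzv ?_ hvD.2 hyD.2
        hwD hsD hc
      rintro rfl
      linarith [hsN.1.2]
    · have hyx : 1 < dist y x := by
        by_contra! h2
        linarith [hout y ⟨hyV, h2⟩]
      exact not_segmentsCross_of_inside hr hxN.2 hpN.2 hw.1 hz.1 hs hvc hyc hpx hwx.2 hxv hpv hwv
        hzv hyv hyx hvE.2 hyE.2 (harc hw) (harc hz) (hE x hxN.1) (hE p hpN.1) hc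
  rcases hcross with h2 | h2
  · exact main x (Or.inl rfl) h2
  · exact main p (Or.inr rfl) h2

end PLDG

theorem lemma8 (V : Set Plane) (hV : V.Finite) (hgp : InGeneralPosition V)
    (χ : PLDG.Choices V) :
    UDel V ≤ PLDG.graph χ := by
  rintro v y ⟨hD, hne, hd⟩
  rw [dist_comm] at hd
  -- The edge set is a union, so survival of the edge at the endpoint `v` suffices.
  refine (SimpleGraph.fromEdgeSet_adj _).2 ⟨Set.mem_iUnion.2 ⟨v, y, rfl, ?_, ?_⟩, hne⟩
  · exact PLDG.isDelaunayEdge_nbhd hD hd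
  · exact fun x c hm => PLDG.not_removes hgp χ hD hd hm
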